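/- Let $\mathbf X^{(1)},\mathbf X^{(2)},\dots$ be independent random vectors, each uniformly distributed in the unit square $(0,1)^2$. For $x,y\in\mathbb R^2$ write $x\prec y$ (equivalently $y\succ x$) if $x_1<y_1$ and $x_2<y_2$. Say that $\mathbf X^{(n)}$ sets a record if $\mathbf X^{(n)}\not\succ\mathbf X^{(i)}$ for all $1\le i<n$, and that $\mathbf X^{(j)}$, $1\le j\le n$, is a current record at time $n$ if $\mathbf X^{(j)}\not\succ\mathbf X^{(i)}$ for all $1\le i\le n$. Let $K_n=-1$ if $\mathbf X^{(n)}$ does not set a record; otherwise let $K_n$ be the number of $j$ with $1\le j<n$ such that $\mathbf X^{(j)}$ is a current record at time $n-1$ but not at time $n$. Let $H_n=\sum_{i=1}^n 1/i$. Then, for all integers $n\ge 1$ and $k\ge 0$, $$\left|\mathbb P(K_n=k)-\left[\frac{2^{-(k+1)}H_n}{n}-\frac{(k-1)2^{-(k+2)}}{n}\right]\right|\le\frac{1}{2n^2}.$$ Consequently, $\mathbb P(K_n\ge 0)>0$ and, with $\alpha_{n,k}:=-(k-1)2^{-(k+2)}/H_n$, $$\left|\mathbb P(K_n=k\mid K_n\ge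 0)-\left[2^{-(k+1)}+\alpha_{n,k}\right]\right|\le\frac{1}{2nH_n}.$$ -/

import Mathlib

open MeasureTheory ProbabilityTheory

namespace ParetoRecords

/-- `p ≺ q`: strict inequality in both coordinates. -/
def Below (p q : ℝ × ℝ) : Prop := p.1 < q.1 ∧ p.2 < q.2

/-- The observation at time `n` sets a (Pareto, record-small) record: it is not strictly above any
earlier observation. Times are `1, 2, …`; the value `x 0` is never used. -/
def IsRecord (x : ℕ → ℝ × ℝ) (n : ℕ) : Prop :=
  ∀ i, 1 ≤ i → i < n → ¬ Below (x i) (x n)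

/-- The `j`-th observation is a current (remaining) record at time `n`. -/
def IsCurrentRecord (x : ℕ → ℝ × ℝ) (n j : ℕ) : Prop :=
  1 ≤ j ∧ j ≤ n ∧ ∀ i, 1 ≤ i → i ≤ n → ¬ Below (x i) (x j)

open Classical in
/-- The times `j < n` of the current records at time `n - 1` that are no longer current at
time `n`. -/
noncomputable def killed (x : ℕ → ℝ × ℝ) (n : ℕ) : Finset ℕ :=
  {j ∈ Finset.Ico 1 n | IsCurrentRecord x (n - 1) j ∧ ¬ IsCurrentRecord x n j}

open Classical in
/-- `K_n`: the number of current records killed by the `n`-th observation if that observation sets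
a record, and `-1` otherwise. -/
noncomputable def K (x : ℕ → ℝ × ℝ) (n : ℕ) : ℤ :=
  if IsRecord x n then ((killed x n).card : ℤ) else -1

/-- The first-order correction `α_{n,k} = -(k - 1) 2^{-(k+2)} / H_n`. -/
noncomputable def alpha (n k : ℕ) : ℝ :=
  -((k : ℝ) - 1) / 2 ^ (k + 2) / (harmonic n : ℝ)

end ParetoRecords

/-! Only the relative orders of the coordinates matter, and these form a uniform pair of
permutations. The points killed at time `n` are those whose sole strict lower bound is the last
point, so the event makes sense for any index and, by exchangeability, has the same probability for
each. Averaging over indices and sorting by first coordinate turns `P(K_n = k)` into `1/(n * n!)`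
times the number of minimal points with `k` kills over all permutations (`measureReal_record`). The
generating function `recordSum` is found by appending the rightmost point. Its rank matters only if
it is `0` (a new minimal point) or `1` (one more kill for the lowest point), so `recordSum` and
`minSum` satisfy a linear recursion. With `W = 1/(2 - z)`, the solution divided by `n!` is `H_n W +
(W - W^2) + (1 - W)^2 ∏_{m<n-1} (z + m) / n!`. The first two terms give the claimed approximation;
`abs_coeff_error_le` bounds the coefficients of the last. At `z = 1` it gives `P(K_n ≥ 0) = H_n /
n`. -/

namespace ParetoRecords

open Finset
open scoped Nat

/-! ### Lower bounds and kills in planar configurations -/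

section Patterns

variable {ι α β : Type*} [Fintype ι] [LinearOrder α] [LinearOrder β]

/-- The indices of the points strictly below the point of index `m`. -/
def belowSet (f : ι → α) (g : ι → β) (m : ι) : Finset ι := {l | f l < f m ∧ g l < g m}

/-- The number of points whose only strict lower bound is the point of index `i`. -/
def kills [DecidableEq ι] (f : ι → α) (g : ι → β) (i : ι) : ℕ := #{m | belowSet f g m = {i}}

lemma belowSet_congr {α' β' : Type*} [LinearOrder α'] [LinearOrder β'] {f : ι → α} {g : ι → β}
    {f' : ι → α'} {g' : ι → β'} (hf : ∀ i j, f i < f j ↔ f' i < f' j)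
    (hg : ∀ i j, g i < g j ↔ g' i < g' j) : belowSet f g = belowSet f' g' := by
  funext m
  simp [belowSet, hf, hg]

lemma belowSet_comp_equiv (e : ι ≃ ι) (f : ι → α) (g : ι → β) (m : ι) :
    (belowSet (f ∘ e) (g ∘ e) m).map e.toEmbedding = belowSet f g (e m) := by
  ext l
  simp [belowSet]

lemma belowSet_comp_equiv_eq_empty (e : ι ≃ ι) (f : ι → α) (g : ι → β) (m : ι) :
    belowSet (f ∘ e) (g ∘ e) m = ∅ ↔ belowSet f g (e m) = ∅ := by
  rw [← belowSet_comp_equiv, Finset.map_eq_empty]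

lemma kills_comp_equiv [DecidableEq ι] (e : ι ≃ ι) (f : ι → α) (g : ι → β) (i : ι) :
    kills (f ∘ e) (g ∘ e) i = kills f g (e i) := by
  unfold kills
  refine Finset.card_equiv e fun m => ?_
  simp only [mem_filter, mem_univ, true_and, ← belowSet_comp_equiv]
  rw [← Finset.map_inj (f := e.toEmbedding) (s₂ := {i})]
  simp

lemma belowSet_eq_empty_of_isMin {f : ι → α} {g : ι → β} {i : ι} (h : ∀ j, g i ≤ g j) :
    belowSet f g i = ∅ := by
  ext l
  simpa [belowSet] using fun _ => h l

end Patterns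

/-! ### Appending a rightmost point: recursions -/

section Append

open Equiv

/-- Append a last entry of relative rank `r` to a permutation in one-line notation. -/
def appendRank {n : ℕ} (r : Fin (n + 1)) (τ : Perm (Fin n)) : Perm (Fin (n + 1)) :=
  (finSuccEquiv' (Fin.last n)).trans ((optionCongr τ).trans (finSuccEquiv' r).symm)

@[simp] lemma appendRank_last {n : ℕ} (r : Fin (n + 1)) (τ : Perm (Fin n)) :
    appendRank r τ (Fin.last n) = r := by
  simp [appendRank]

@[simp] lemma appendRank_castSucc {n : ℕ} (r : Fin (n + 1)) (τ : Perm (Fin n)) (i : Fin n) :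
    appendRank r τ i.castSucc = r.succAbove (τ i) := by
  rw [← Fin.succAbove_last_apply]
  simp [appendRank, -Fin.succAbove_last]

lemma appendRank_bijective (n : ℕ) :
    Function.Bijective fun p : Fin (n + 1) × Perm (Fin n) => appendRank p.1 p.2 := by
  rw [Fintype.bijective_iff_injective_and_card]
  constructor
  · rintro ⟨r, τ⟩ ⟨s, υ⟩ h
    have hr : r = s := by simpa using congrArg (fun e : Perm (Fin (n + 1)) => e (Fin.last n)) h
    subst hr
    refine Prod.ext rfl (Equiv.ext fun i => ?_)
    simpa using congrArg (fun e : Perm (Fin (n + 1)) => e i.castSucc) h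
  · simp [Fintype.card_perm, Nat.factorial_succ]

lemma sum_perm_succ {M : Type*} [AddCommMonoid M] {n : ℕ} (F : Perm (Fin (n + 1)) → M) :
    ∑ τ, F τ = ∑ r, ∑ τ : Perm (Fin n), F (appendRank r τ) := by
  rw [← (appendRank_bijective n).sum_comp F, Fintype.sum_prod_type]

variable {n : ℕ}

lemma belowSet_appendRank_castSucc (r : Fin (n + 1)) (τ : Perm (Fin n)) (m : Fin n) :
    belowSet id (appendRank r τ) m.castSucc = (belowSet id τ m).map Fin.castSuccEmb := by
  ext l
  induction l using Fin.lastCases with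
  | last => simp [belowSet, Fin.castSucc_ne_last, (Fin.castSucc_lt_last m).not_gt]
  | cast l => simp [belowSet]

lemma mem_belowSet_appendRank_last (r : Fin (n + 1)) (τ : Perm (Fin n)) (l : Fin (n + 1)) :
    l ∈ belowSet id (appendRank r τ) (Fin.last n) ↔ ∃ i : Fin n, i.castSucc = l ∧ (τ i : ℕ) < r := by
  induction l using Fin.lastCases with
  | last => simp [belowSet]
  | cast l => 
    simp only [belowSet, mem_filter, mem_univ, id_eq, Fin.castSucc_lt_last, appendRank_castSucc,
      appendRank_last, Fin.succAbove_lt_iff_castSucc_lt, true_and, Fin.castSucc_inj,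
      exists_eq_left]
    exact Iff.rfl

lemma belowSet_appendRank_last_eq_empty (r : Fin (n + 2)) (τ : Perm (Fin (n + 1))) :
    belowSet id (appendRank r τ) (Fin.last (n + 1)) = ∅ ↔ r = 0 := by
  simp only [Finset.eq_empty_iff_forall_notMem, mem_belowSet_appendRank_last]
  constructor
  · intro h
    by_contra hr
    refine h (τ.symm 0).castSucc ⟨_, rfl, ?_⟩
    rw [Equiv.apply_symm_apply]
    exact Fin.pos_of_ne_zero hr
  · rintro rfl l ⟨i, -, hi⟩
    simp at hi

lemma belowSet_appendRank_last_eq_singleton (r : Fin (n + 2)) (τ : Perm (Fin (n + 1)))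
    (i : Fin (n + 1)) :
    belowSet id (appendRank r τ) (Fin.last (n + 1)) = {i.castSucc} ↔ r = 1 ∧ i = τ.symm 0 := by
  simp only [Finset.ext_iff, mem_belowSet_appendRank_last, mem_singleton]
  constructor
  · intro h
    obtain ⟨j, hj, hi⟩ := (h i.castSucc).2 rfl
    obtain rfl := Fin.castSucc_injective _ hj
    have hi0 : τ.symm 0 = j := Fin.castSucc_injective _ <| (h _).1 ⟨_, rfl, by
      rw [Equiv.apply_symm_apply]; exact (Nat.zero_le _).trans_lt hi⟩
    refine ⟨?_, hi0.symm⟩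
    -- A rank above `1` would put the entries with values `0` and `1` both below the last point.
    by_contra hr
    have hr1 : 1 < (r : ℕ) := by
      have : (r : ℕ) ≠ 1 := fun h => hr (Fin.ext (by simpa using h))
      omega
    have hn : 1 < n + 1 := by omega
    have hi1 : τ.symm ⟨1, hn⟩ = j := Fin.castSucc_injective _ <| (h _).1 ⟨_, rfl, by simpa using hr1⟩
    have := τ.symm.injective (hi0.trans hi1.symm)
    simp [Fin.ext_iff] at this
  · rintro ⟨rfl, rfl⟩ l
    constructor
    · rintro ⟨i, rfl, hi⟩
      have : τ i = 0 := Fin.ext (by simpa using hi)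
      rw [← this, Equiv.symm_apply_apply]
    · rintro rfl
      exact ⟨_, rfl, by simp⟩

lemma kills_appendRank_castSucc (r : Fin (n + 2)) (τ : Perm (Fin (n + 1))) (i : Fin (n + 1)) :
    kills id (appendRank r τ) i.castSucc
      = kills id τ i + if r = 1 ∧ i = τ.symm 0 then 1 else 0 := by
  have key (m : Fin (n + 1)) : belowSet id (appendRank r τ) m.castSucc = {i.castSucc} ↔
      belowSet id τ m = {i} := by
    rw [belowSet_appendRank_castSucc, ← Finset.map_inj (f := Fin.castSuccEmb) (s₂ := {i})]
    simp
  simp only [kills, Finset.card_filter, Fin.sum_univ_castSucc, key,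
    belowSet_appendRank_last_eq_singleton]

lemma kills_appendRank_last (r : Fin (n + 1)) (τ : Perm (Fin n)) :
    kills id (appendRank r τ) (Fin.last n) = 0 := by
  rw [kills, Finset.card_eq_zero, Finset.filter_eq_empty_iff]
  intro m _ h
  have : Fin.last n ∈ belowSet id (appendRank r τ) m := by simp [h]
  simp [belowSet, Fin.not_lt.2 (Fin.le_last m)] at this

variable {R : Type*} [CommRing R]

/-- Total weight of all records of permutations of `n` points, a record with `k` kills having
weight `z ^ k`. -/
def recordSum (z : R) (n : ℕ) : R :=
  ∑ τ : Perm (Fin n), ∑ i, if belowSet id τ i = ∅ then z ^ kills id τ i else 0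

/-- Total weight of the minimal entries of permutations of `n + 1` points. -/
def minSum (z : R) (n : ℕ) : R :=
  ∑ τ : Perm (Fin (n + 1)), z ^ kills id τ (τ.symm 0)

/-- The rightmost point lies below no other, so old records survive and it has no kills itself. For
`r = 1` the weight of the least entry is multiplied by `z`; for `r = 0` a record of weight `1`
appears. -/
lemma sum_record_appendRank (z : R) (r : Fin (n + 2)) (τ : Perm (Fin (n + 1))) :
    (∑ i, if belowSet id (appendRank r τ) i = ∅ then z ^ kills id (appendRank r τ) i else 0)
      = (∑ i, if belowSet id τ i = ∅ then z ^ kills id τ i else 0)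
        + (if r = 1 then (z - 1) * z ^ kills id τ (τ.symm 0) else 0) + if r = 0 then 1 else 0 := by
  rw [Fin.sum_univ_castSucc]
  simp only [belowSet_appendRank_castSucc, Finset.map_eq_empty, kills_appendRank_castSucc,
    belowSet_appendRank_last_eq_empty, kills_appendRank_last, pow_zero]
  congr 1
  split_ifs with hr
  · subst hr
    rw [← Finset.sum_erase_add _ _ (mem_univ (τ.symm 0)),
      ← Finset.sum_erase_add univ (fun i => if belowSet id τ i = ∅ then z ^ kills id τ i else 0)
        (mem_univ (τ.symm 0))]
    have h0 : belowSet id τ (τ.symm 0) = ∅ := belowSet_eq_empty_of_isMin (by simp)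
    rw [Finset.sum_congr rfl (g := fun i => if belowSet id τ i = ∅ then z ^ kills id τ i else 0)]
    · simp only [h0, and_self, if_true]
      ring
    · intro i hi
      simp [Finset.ne_of_mem_erase hi]
  · simp [hr]

lemma recordSum_add_two (z : R) (n : ℕ) :
    recordSum z (n + 2)
      = (n + 2) * recordSum z (n + 1) + (z - 1) * minSum z n + ((n + 1)! : ℕ) := by
  rw [recordSum, sum_perm_succ]
  simp only [sum_record_appendRank, Finset.sum_add_distrib]
  rw [← recordSum]
  simp [minSum, Finset.mul_sum, Fintype.card_perm]
  ring

lemma appendRank_symm_zero (r : Fin (n + 1)) (τ : Perm (Fin (n + 1))) :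
    (appendRank r.succ τ).symm 0 = (τ.symm 0).castSucc := by
  rw [Equiv.symm_apply_eq, appendRank_castSucc, Equiv.apply_symm_apply]
  simp

/-- Rank `0` replaces the least entry by one without kills, rank `1` gives it one more kill, and the
other `n` ranks change nothing. -/
lemma minSum_succ (z : R) (n : ℕ) :
    minSum z (n + 1) = ((n + 1)! : ℕ) + (z + n) * minSum z n := by
  rw [minSum, sum_perm_succ, Fin.sum_univ_succ, Fin.sum_univ_succ]
  have h0 (τ : Perm (Fin (n + 1))) : (appendRank 0 τ).symm 0 = Fin.last _ := by
    rw [Equiv.symm_apply_eq, appendRank_last]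
  have h1 (j : Fin n) : ¬ (j.succ.succ = (1 : Fin (n + 2))) := by
    simp [Fin.ext_iff]
  have h2 (τ : Perm (Fin (n + 1))) : (appendRank 1 τ).symm 0 = (τ.symm 0).castSucc :=
    appendRank_symm_zero 0 τ
  simp [appendRank_symm_zero, h0, h2, kills_appendRank_last, kills_appendRank_castSucc, h1,
    Fintype.card_perm, minSum, pow_succ, ← Finset.sum_mul]
  ring

lemma minSum_zero (z : R) : minSum z 0 = 1 := by
  have h (τ : Perm (Fin 1)) (i : Fin 1) : kills id τ i = 0 := by
    simp [kills, belowSet, Subsingleton.elim _ i]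
  simp [minSum, h]

lemma recordSum_one (z : R) : recordSum z 1 = 1 := by
  have h (τ : Perm (Fin 1)) (i : Fin 1) : kills id τ i = 0 := by
    simp [kills, belowSet, Subsingleton.elim _ i]
  simp [recordSum, h, belowSet]

end Append

end ParetoRecords

namespace ParetoRecords

open Finset
open scoped Nat

/-! ### Solving the recursions and estimating coefficients -/

section GeneratingFunction

variable {A : Type*} [CommRing A]

lemma two_sub_mul_recordSum [Algebra ℝ A] (z : A) (n : ℕ) :
    (2 - z) * recordSum z (n + 1)
      = algebraMap ℝ A ((n + 1)! * (harmonic (n + 1) : ℝ)) + (1 - z) * minSum z n := by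
  induction n with
  | zero =>
    simp [recordSum_one, minSum_zero, harmonic]
    ring
  | succ n ih =>
    have hH : ((n + 1 + 1)! : ℝ) * (harmonic (n + 1 + 1) : ℝ)
        = (n + 2) * ((n + 1)! * (harmonic (n + 1) : ℝ)) + ((n + 1)! : ℕ) := by
      rw [harmonic_succ (n + 1), Nat.factorial_succ (n + 1)]
      push_cast
      field_simp
      ring
    rw [hH, recordSum_add_two, minSum_succ]
    simp only [map_add, map_mul _ ((n : ℝ) + 2), map_natCast, map_ofNat]
    linear_combination ((n : A) + 2) * ih

lemma two_sub_mul_minSum (z : A) (n : ℕ) :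
    (2 - z) * minSum z n = ((n + 1)! : ℕ) + (1 - z) * ∏ m ∈ range n, (z + m) := by
  induction n with
  | zero =>
    simp [minSum_zero]
    ring
  | succ n ih =>
    rw [minSum_succ, Finset.prod_range_succ, Nat.factorial_succ (n + 1)]
    push_cast at ih ⊢
    linear_combination (z + n) * ih

lemma recordSum_one_right (n : ℕ) :
    recordSum (1 : ℝ) (n + 1) = (n + 1)! * (harmonic (n + 1) : ℝ) := by
  have h := two_sub_mul_recordSum (1 : ℝ) n
  norm_num at h
  simpa using h

open PowerSeries

/-- The power series `1 / (2 - X)`. -/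
noncomputable def invTwoSub : ℝ⟦X⟧ := PowerSeries.mk fun k => 1 / 2 ^ (k + 1)

/-- The power series `1 / (2 - X) ^ 2`. -/
noncomputable def invTwoSubSq : ℝ⟦X⟧ := PowerSeries.mk fun k => (k + 1) / 2 ^ (k + 2)

lemma coeff_two_sub_mul (S : ℝ⟦X⟧) (k : ℕ) :
    coeff (k + 1) ((2 - X) * S) = 2 * coeff (k + 1) S - coeff k S := by
  rw [sub_mul, map_sub, coeff_succ_X_mul, ← map_ofNat (PowerSeries.C (R := ℝ)) 2, coeff_C_mul]

lemma coeff_zero_two_sub_mul (S : ℝ⟦X⟧) : coeff 0 ((2 - X) * S) = 2 * coeff 0 S := by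
  rw [sub_mul, map_sub, coeff_zero_X_mul, ← map_ofNat (PowerSeries.C (R := ℝ)) 2, coeff_C_mul,
    sub_zero]

lemma two_sub_mul_invTwoSub : (2 - X) * invTwoSub = 1 := by
  ext k
  cases k with
  | zero => simp only [coeff_zero_two_sub_mul, invTwoSub, coeff_mk, coeff_zero_one]; norm_num
  | succ k =>
    simp only [coeff_two_sub_mul, invTwoSub, coeff_mk, coeff_one]
    simp
    field_simp
    ring

lemma two_sub_mul_invTwoSubSq : (2 - X) * invTwoSubSq = invTwoSub := by
  ext k
  cases k with
  | zero => simp only [coeff_zero_two_sub_mul, invTwoSub, invTwoSubSq, coeff_mk]; norm_num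
  | succ k =>
    simp only [coeff_two_sub_mul, invTwoSub, invTwoSubSq, coeff_mk]
    push_cast
    field_simp
    ring

lemma recordSum_X (n : ℕ) :
    recordSum (X : ℝ⟦X⟧) (n + 1)
      = C ((n + 1)! * (harmonic (n + 1) : ℝ)) * invTwoSub
        + C ((n + 1)! : ℝ) * (invTwoSub - invTwoSubSq)
        + (1 - 2 * invTwoSub + invTwoSubSq) * ∏ m ∈ range n, (X + (m : ℝ⟦X⟧)) := by
  have h1 := two_sub_mul_recordSum (X : ℝ⟦X⟧) n
  have h2 := two_sub_mul_minSum (X : ℝ⟦X⟧) n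
  have h3 := two_sub_mul_invTwoSub
  have h4 := two_sub_mul_invTwoSubSq
  have hU : invTwoSubSq = invTwoSub ^ 2 := by
    linear_combination invTwoSub * h4 - invTwoSubSq * h3
  rw [PowerSeries.algebraMap_apply, Algebra.algebraMap_self, RingHom.id_apply] at h1
  rw [show (C ((n + 1)! : ℝ) : ℝ⟦X⟧) = (((n + 1)! : ℕ) : ℝ⟦X⟧) from map_natCast _ _, hU]
  set W := invTwoSub
  have h5 : (1 - X) * W = 1 - W := by linear_combination h3
  have h6 : minSum X n = (((n + 1)! : ℕ) : ℝ⟦X⟧) * W + (1 - W) * ∏ m ∈ range n, (X + (m : ℝ⟦X⟧)) := by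
    linear_combination W * h2 - minSum X n * h3 + (∏ m ∈ range n, (X + (m : ℝ⟦X⟧))) * h5
  have h7 : recordSum X (n + 1) = C ((n + 1)! * (harmonic (n + 1) : ℝ)) * W
      + (1 - W) * minSum X n := by
    linear_combination W * h1 - recordSum X (n + 1) * h3 + minSum X n * h5
  rw [h7, h6]
  ring

/-- The coefficients of `(1 - W)^2` are at most `1/4` in absolute value, and multiplying by `X + m`
enlarges a uniform bound by at most the factor `m + 1`. -/
lemma abs_coeff_error_le (n k : ℕ) :
    |coeff k ((1 - 2 * invTwoSub + invTwoSubSq) * ∏ m ∈ range n, (X + (m : ℝ⟦X⟧)))|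
      ≤ (n ! : ℝ) / 4 := by
  induction n generalizing k with
  | zero =>
    rw [Finset.prod_range_zero, mul_one, map_add, map_sub,
      ← map_ofNat (PowerSeries.C (R := ℝ)) 2, coeff_C_mul]
    simp only [invTwoSub, invTwoSubSq, coeff_mk, coeff_one]
    rcases k with _ | k
    · norm_num [abs_le]
    · have h : (k : ℝ) + 1 ≤ 2 ^ k := by exact_mod_cast Nat.lt_two_pow_self
      have h2 : (2 : ℝ) ^ (k + 1 + 2) = 8 * 2 ^ k := by ring
      have h3 : (2 : ℝ) ^ (k + 1 + 1) = 4 * 2 ^ k := by ring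
      have h4 : (0 : ℝ) < 2 ^ k := by positivity
      have h5 : (0 : ℝ) ≤ k := by positivity
      have e : (if k + 1 = 0 then (1 : ℝ) else 0) - 2 * (1 / 2 ^ (k + 1 + 1))
          + ((k + 1 : ℕ) + 1) / 2 ^ (k + 1 + 2) = (k - 2) / (8 * 2 ^ k) := by
        rw [h2, h3, if_neg (by omega)]
        push_cast
        field_simp
        ring
      rw [e, abs_div, abs_of_pos (by positivity : (0 : ℝ) < 8 * 2 ^ k),
        div_le_div_iff₀ (by positivity) (by norm_num)]
      simp only [Nat.factorial_zero, Nat.cast_one, one_mul]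
      have : |(k : ℝ) - 2| ≤ 2 * 2 ^ k := by
        rw [abs_le]
        constructor <;> linarith
      linarith
  | succ n ih =>
    rw [Finset.prod_range_succ, ← mul_assoc]
    set S := (1 - 2 * invTwoSub + invTwoSubSq) * ∏ m ∈ range n, (X + (m : ℝ⟦X⟧))
    rw [mul_add, map_add, ← map_natCast (PowerSeries.C (R := ℝ)) n, coeff_mul_C,
      Nat.factorial_succ]
    have h1 : |coeff k S * n| ≤ (n ! : ℝ) / 4 * n := by
      rw [abs_mul, Nat.abs_cast]
      exact mul_le_mul_of_nonneg_right (ih k) (by positivity)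
    have h2 : |coeff k (S * X)| ≤ (n ! : ℝ) / 4 := by
      cases k with
      | zero =>
        rw [coeff_zero_mul_X, abs_zero]
        positivity
      | succ k =>
        rw [coeff_succ_mul_X]
        exact ih k
    refine (abs_add_le _ _).trans ((add_le_add h2 h1).trans (le_of_eq ?_))
    push_cast
    ring

lemma abs_coeff_recordSum_sub_le (n k : ℕ) :
    |coeff k (recordSum (X : ℝ⟦X⟧) (n + 1)) / (n + 1)!
      - ((harmonic (n + 1) : ℝ) / 2 ^ (k + 1) - ((k : ℝ) - 1) / 2 ^ (k + 2))|
      ≤ 1 / (4 * (n + 1)) := by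
  have h := abs_coeff_error_le n k
  rw [recordSum_X, map_add, map_add, coeff_C_mul, coeff_C_mul, map_sub]
  set E := coeff k ((1 - 2 * invTwoSub + invTwoSubSq) * ∏ m ∈ range n, (X + (m : ℝ⟦X⟧)))
  have hn : ((n + 1)! : ℝ) = (n + 1) * n ! := by
    rw [Nat.factorial_succ]
    push_cast
    rfl
  have hpos : (0 : ℝ) < n ! := by positivity
  simp only [invTwoSub, invTwoSubSq, coeff_mk]
  have e : (((n + 1)! : ℝ) * (harmonic (n + 1) : ℝ) * (1 / 2 ^ (k + 1))
      + ((n + 1)! : ℝ) * (1 / 2 ^ (k + 1) - ((k : ℝ) + 1) / 2 ^ (k + 2)) + E) / (n + 1)!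
      - ((harmonic (n + 1) : ℝ) / 2 ^ (k + 1) - ((k : ℝ) - 1) / 2 ^ (k + 2))
      = E / ((n + 1) * n !) := by
    rw [hn]
    field_simp
    ring
  rw [e, abs_div, abs_of_pos (by positivity : (0 : ℝ) < (n + 1) * n !),
    div_le_div_iff₀ (by positivity) (by positivity)]
  nlinarith [h]

end GeneratingFunction

end ParetoRecords

namespace ParetoRecords

open Finset
open scoped Nat

/-! ### Order cells of a uniform vector -/

section OrderCells

open Equiv

/-- The vectors whose coordinates are ordered like the values of `σ`. -/
def orderCell {n : ℕ} (σ : Perm (Fin n)) : Set (Fin n → ℝ) :=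
  {x | ∀ i j, x i < x j ↔ σ i < σ j}

lemma measurableSet_orderCell {n : ℕ} (σ : Perm (Fin n)) : MeasurableSet (orderCell σ) := by
  simp only [orderCell, Set.ofPred_forall]
  refine MeasurableSet.iInter fun i => MeasurableSet.iInter fun j => ?_
  exact MeasurableSet.iff (measurableSet_lt (measurable_pi_apply i) (measurable_pi_apply j))
    (MeasurableSet.const _)

lemma eq_of_lt_iff_lt {n : ℕ} {σ τ : Perm (Fin n)} (h : ∀ i j, σ i < σ j ↔ τ i < τ j) : σ = τ := by
  have hm : StrictMono (τ.symm.trans σ) := fun i j hij => by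
    simpa [h] using hij
  have h1 : τ.symm.trans σ = Equiv.refl _ := by
    -- The identity is the only order automorphism of `Fin n`.
    have := Subsingleton.elim
      (StrictMono.orderIsoOfSurjective _ hm (Equiv.surjective _)) (OrderIso.refl (Fin n))
    ext i
    exact congrArg (fun e : Fin n ≃o Fin n => (e i : ℕ)) this
  ext i
  have := congrArg (fun e : Perm (Fin n) => (e (τ i) : ℕ)) h1
  simpa using this

lemma pairwise_disjoint_orderCell (n : ℕ) :
    Pairwise (Function.onFun Disjoint (orderCell (n := n))) := by
  intro σ τ h
  rw [Function.onFun, Set.disjoint_left]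
  exact fun x hσ hτ => h (eq_of_lt_iff_lt fun i j => (hσ i j).symm.trans (hτ i j))

lemma exists_mem_orderCell {n : ℕ} {x : Fin n → ℝ} (hx : Function.Injective x) :
    ∃ σ, x ∈ orderCell σ := by
  have hm : StrictMono (x ∘ Tuple.sort x) :=
    (Tuple.monotone_sort x).strictMono_of_injective (hx.comp (Equiv.injective _))
  refine ⟨(Tuple.sort x).symm, fun i j => ?_⟩
  rw [← hm.lt_iff_lt]
  simp

/-- The uniform distribution on the unit interval. -/
noncomputable def unif : Measure ℝ := volume.restrict (Set.Ioo 0 1)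

instance : IsProbabilityMeasure unif := ⟨by simp [unif]⟩

/-- Ties lie in finitely many proper subspaces `x i = x j`, which are Lebesgue null. -/
lemma ae_injective_pi_unif (n : ℕ) :
    ∀ᵐ x ∂(Measure.pi fun _ : Fin n => unif), Function.Injective x := by
  have hac : (Measure.pi fun _ : Fin n => unif) ≪ (volume : Measure (Fin n → ℝ)) := by
    unfold unif
    rw [← Measure.restrict_pi_pi (fun _ : Fin n => (volume : Measure ℝ)), ← volume_pi]
    exact Measure.absolutelyContinuous_of_le Measure.restrict_le_self
  refine hac.ae_le ?_
  have h (i j : Fin n) (hij : i ≠ j) : ∀ᵐ x : Fin n → ℝ, x i ≠ x j := by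
    let s : Submodule ℝ (Fin n → ℝ) :=
      LinearMap.ker ((LinearMap.proj i : (Fin n → ℝ) →ₗ[ℝ] ℝ) - LinearMap.proj j)
    have hs : s ≠ ⊤ := fun htop => by
      have : Pi.single i (1 : ℝ) ∈ s := htop ▸ Submodule.mem_top
      simp [s, hij.symm] at this
    have := Measure.addHaar_submodule volume s hs
    rw [ae_iff]
    convert this using 2
    ext x
    simp [s, sub_eq_zero]
  have h' : ∀ᵐ x : Fin n → ℝ, ∀ i j, i ≠ j → x i ≠ x j := by
    simp only [ae_all_iff]
    exact h
  filter_upwards [h'] with x hx i j hij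
  by_contra hne
  exact hx i j hne hij

/-- Permuting coordinates preserves the product measure and permutes the `n!` disjoint cells, which
cover almost everything. -/
lemma pi_unif_orderCell {n : ℕ} (σ : Perm (Fin n)) :
    (Measure.pi fun _ : Fin n => unif).real (orderCell σ) = 1 / n ! := by
  set ν := Measure.pi fun _ : Fin n => unif
  have hsymm (σ : Perm (Fin n)) : ν.real (orderCell σ) = ν.real (orderCell 1) := by
    have hmp := measurePreserving_arrowCongr' (fun _ : Fin n => unif) (fun _ : Fin n => unif) σ
      (MeasurableEquiv.refl ℝ) (fun _ => MeasurePreserving.id _)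
    rw [← hmp.measureReal_preimage (measurableSet_orderCell 1).nullMeasurableSet]
    congr 1
    ext x
    have hx (i : Fin n) : MeasurableEquiv.arrowCongr' σ (MeasurableEquiv.refl ℝ) x i
        = x (σ.symm i) := rfl
    simp only [orderCell, Set.mem_ofPred_eq, Set.mem_preimage, hx]
    constructor
    · intro h i j
      have := h (σ.symm i) (σ.symm j)
      simpa using this
    · intro h i j
      have := h (σ i) (σ j)
      simpa using this
  have hcover : ν.real (⋃ σ, orderCell σ) = 1 := by
    have : (⋃ σ, orderCell σ) =ᵐ[ν] Set.univ := by
      filter_upwards [ae_injective_pi_unif n] with x hx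
      exact eq_true (Set.mem_iUnion.2 (exists_mem_orderCell hx))
    rw [measureReal_congr this]
    simp
  rw [measureReal_iUnion_fintype (pairwise_disjoint_orderCell n) measurableSet_orderCell] at hcover
  simp only [hsymm, sum_const, Finset.card_univ, Fintype.card_perm, Fintype.card_fin, nsmul_eq_mul]
    at hcover
  rw [hsymm σ, eq_div_iff (by positivity)]
  linarith

end OrderCells

/-! ### From probabilities to counting permutations -/

section Law

open Equiv

variable {Ω : Type*} [MeasurableSpace Ω] {μ : Measure Ω} [IsProbabilityMeasure μ]
  {X : ℕ → Ω → ℝ × ℝ}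

lemma map_coordinates (hmeas : ∀ i, 1 ≤ i → Measurable (X i))
    (hindep : iIndepFun (fun i : ℕ => X (i + 1)) μ)
    (hunif : ∀ i, 1 ≤ i →
      pdf.IsUniform (X i) (Set.Ioo (0 : ℝ) 1 ×ˢ Set.Ioo (0 : ℝ) 1) μ volume) (n : ℕ) :
    MeasurePreserving (fun ω => ((fun i : Fin n => (X (i + 1) ω).1), fun i : Fin n => (X (i + 1) ω).2))
      μ ((Measure.pi fun _ : Fin n => unif).prod (Measure.pi fun _ : Fin n => unif)) := by
  have hm (i : Fin n) : Measurable (X (i + 1)) := hmeas _ (by omega)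
  have hlaw (i : Fin n) : μ.map (X (i + 1)) = unif.prod unif := by
    have h := hunif (i + 1) (by omega)
    rw [pdf.IsUniform] at h
    rw [h, ProbabilityTheory.cond, unif, Measure.prod_restrict, Measure.volume_eq_prod]
    simp
  have hpi := (iIndepFun_iff_map_fun_eq_pi_map (fun i => (hm i).aemeasurable)).1
    (hindep.precomp (g := fun i : Fin n => (i : ℕ)) Fin.val_injective)
  simp only [hlaw] at hpi
  have h1 : MeasurePreserving (fun ω (i : Fin n) => X (i + 1) ω) μ
      (Measure.pi fun _ : Fin n => unif.prod unif) :=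
    ⟨measurable_pi_lambda _ hm, hpi⟩
  exact (measurePreserving_arrowProdEquivProdArrow ℝ ℝ (Fin n) (fun _ => unif)
    (fun _ => unif)).comp h1

/-- The law of an order-invariant event is obtained by counting pairs of permutations. -/
lemma measureReal_eq_card_div {n : ℕ} {f : Ω → (Fin n → ℝ) × (Fin n → ℝ)}
    (hf : MeasurePreserving f μ
      ((Measure.pi fun _ : Fin n => unif).prod (Measure.pi fun _ : Fin n => unif)))
    (E : Set Ω) (P : Perm (Fin n) × Perm (Fin n) → Prop) [DecidablePred P]
    (h : ∀ ω σ τ, (f ω).1 ∈ orderCell σ → (f ω).2 ∈ orderCell τ → (ω ∈ E ↔ P (σ, τ))) :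
    μ.real E = #{p | P p} / (n ! : ℝ) ^ 2 := by
  let cell (p : Perm (Fin n) × Perm (Fin n)) : Set Ω := f ⁻¹' (orderCell p.1 ×ˢ orderCell p.2)
  have hms (p : Perm (Fin n) × Perm (Fin n)) :
      MeasurableSet (orderCell p.1 ×ˢ orderCell p.2) :=
    (measurableSet_orderCell _).prod (measurableSet_orderCell _)
  have hcell (p) : μ.real (cell p) = 1 / (n ! : ℝ) ^ 2 := by
    rw [hf.measureReal_preimage (hms p).nullMeasurableSet, measureReal_prod_prod,
      pi_unif_orderCell, pi_unif_orderCell]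
    ring
  have hae : ∀ᵐ ω ∂μ, ∃ p, ω ∈ cell p := by
    have h1 := (hf.quasiMeasurePreserving.tendsto_ae).eventually
      (Measure.quasiMeasurePreserving_fst.tendsto_ae.eventually (ae_injective_pi_unif n))
    have h2 := (hf.quasiMeasurePreserving.tendsto_ae).eventually
      (Measure.quasiMeasurePreserving_snd.tendsto_ae.eventually (ae_injective_pi_unif n))
    filter_upwards [h1, h2] with ω h1 h2
    obtain ⟨σ, hσ⟩ := exists_mem_orderCell h1
    obtain ⟨τ, hτ⟩ := exists_mem_orderCell h2
    exact ⟨(σ, τ), hσ, hτ⟩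
  -- Measurability of `E` is not needed: it agrees almost everywhere with a finite union of cells.
  have hE : E =ᵐ[μ] ⋃ p ∈ ({p | P p} : Finset (Perm (Fin n) × Perm (Fin n))), cell p := by
    filter_upwards [hae] with ω ⟨p, hp⟩
    refine propext ⟨fun hω => ?_, fun hω => ?_⟩
    · exact Set.mem_biUnion (by simpa using (h ω p.1 p.2 hp.1 hp.2).1 hω) hp
    · obtain ⟨q, hq, hωq⟩ := Set.mem_iUnion₂.1 hω
      exact (h ω q.1 q.2 hωq.1 hωq.2).2 (by simpa using hq)
  rw [measureReal_congr hE, measureReal_biUnion_finset]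
  · simp [hcell, div_eq_mul_inv]
  · intro p _ q _ hpq
    refine Set.disjoint_left.2 fun ω hp hq => hpq (Prod.ext ?_ ?_)
    · by_contra hne
      exact Set.disjoint_left.1 (pairwise_disjoint_orderCell n hne) hp.1 hq.1
    · by_contra hne
      exact Set.disjoint_left.1 (pairwise_disjoint_orderCell n hne) hp.2 hq.2
  · exact fun p _ => hf.measurable (hms p)

lemma card_mul_sum_perm_apply {n : ℕ} (h : Fin n → ℝ) (i : Fin n) :
    n * ∑ σ : Perm (Fin n), h (σ i) = n ! * ∑ j, h j := by
  have hi (j : Fin n) : ∑ σ : Perm (Fin n), h (σ j) = ∑ σ : Perm (Fin n), h (σ i) := by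
    rw [← Equiv.sum_comp (Equiv.mulRight (swap i j))]
    simp
  calc n * ∑ σ : Perm (Fin n), h (σ i) = ∑ j, ∑ σ : Perm (Fin n), h (σ j) := by simp [hi]
    _ = ∑ σ : Perm (Fin n), ∑ j, h (σ j) := Finset.sum_comm
    _ = _ := by simp [Equiv.sum_comp, Fintype.card_perm]

/-- Relabelling points by `σ` makes the first coordinate the identity and sends index `i` to `σ i`,
which is equidistributed over `Fin n`. -/
lemma card_mul_card_pairs {n : ℕ} (Q : ℕ → Prop) [DecidablePred Q] (i : Fin n) :
    (n : ℝ) * #{p : Perm (Fin n) × Perm (Fin n) |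
        belowSet p.1 p.2 i = ∅ ∧ Q (kills p.1 p.2 i)}
      = n ! * ∑ τ : Perm (Fin n), (#{j | belowSet id τ j = ∅ ∧ Q (kills id τ j)} : ℝ) := by
  have hrel (σ τ : Perm (Fin n)) : (belowSet σ (σ.trans τ) i = ∅ ∧ Q (kills σ (σ.trans τ) i)) ↔
      (belowSet id τ (σ i) = ∅ ∧ Q (kills id τ (σ i))) := by
    have h1 := belowSet_comp_equiv_eq_empty σ id τ i
    have h2 := kills_comp_equiv σ id τ i
    rw [← h1, ← h2]
    rfl
  have hsum (σ : Perm (Fin n)) :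
      (∑ τ : Perm (Fin n), if belowSet σ τ i = ∅ ∧ Q (kills σ τ i) then (1 : ℝ) else 0)
        = ∑ τ : Perm (Fin n),
          if belowSet id τ (σ i) = ∅ ∧ Q (kills id τ (σ i)) then (1 : ℝ) else 0 := by
    rw [← Equiv.sum_comp (Equiv.mulRight σ)]
    refine Finset.sum_congr rfl fun τ _ => ?_
    exact if_congr (hrel σ τ) rfl rfl
  simp only [Finset.card_filter, Nat.cast_sum, Fintype.sum_prod_type, Nat.cast_ite, Nat.cast_one,
    Nat.cast_zero, hsum]
  rw [card_mul_sum_perm_apply (fun j => ∑ τ : Perm (Fin n),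
          if belowSet id τ j = ∅ ∧ Q (kills id τ j) then (1 : ℝ) else 0), Finset.sum_comm]

lemma measureReal_record (hmeas : ∀ i, 1 ≤ i → Measurable (X i))
    (hindep : iIndepFun (fun i : ℕ => X (i + 1)) μ)
    (hunif : ∀ i, 1 ≤ i →
      pdf.IsUniform (X i) (Set.Ioo (0 : ℝ) 1 ×ˢ Set.Ioo (0 : ℝ) 1) μ volume)
    {n : ℕ} (i : Fin n) (Q : ℕ → Prop) [DecidablePred Q] :
    μ.real {ω | belowSet (fun j : Fin n => (X (j + 1) ω).1) (fun j => (X (j + 1) ω).2) i = ∅ ∧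
        Q (kills (fun j : Fin n => (X (j + 1) ω).1) (fun j => (X (j + 1) ω).2) i)}
      = (∑ τ : Perm (Fin n), (#{j | belowSet id τ j = ∅ ∧ Q (kills id τ j)} : ℝ)) / n ! / n := by
  have hn : (0 : ℝ) < n := by exact_mod_cast i.pos
  rw [measureReal_eq_card_div (map_coordinates hmeas hindep hunif n) _
    (fun p => belowSet p.1 p.2 i = ∅ ∧ Q (kills p.1 p.2 i))]
  · have h := card_mul_card_pairs Q i
    field_simp
    linarith
  · intro ω σ τ hσ hτ
    have hb := belowSet_congr hσ hτ
    simp only [Set.mem_ofPred_eq, kills, hb]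

end Law

/-! ### Records and kills in the time-indexed sequence -/

section Transfer

lemma isRecord_iff (x : ℕ → ℝ × ℝ) (n : ℕ) :
    IsRecord x (n + 1) ↔
      belowSet (fun j : Fin (n + 1) => (x (j + 1)).1) (fun j => (x (j + 1)).2) (Fin.last n) = ∅ := by
  simp only [IsRecord, Below, belowSet, Finset.filter_eq_empty_iff, mem_univ, true_imp_iff,
    Fin.val_last]
  constructor
  · intro h j
    rcases (Nat.lt_succ_iff_lt_or_eq.1 j.isLt) with hj | hj
    · exact h (j + 1) (by omega) (by omega)
    · simp [hj]
  · intro h i h1 h2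
    have := @h ⟨i - 1, by omega⟩
    simpa [Nat.sub_add_cancel h1] using this

/-- Being current at time `n` but not at `n + 1` means that observation `n + 1` is the only strict
lower bound. Index `m` of `Fin (n + 1)` stands for time `m + 1`. -/
lemma card_killed (x : ℕ → ℝ × ℝ) (n : ℕ) :
    (killed x (n + 1)).card
      = kills (fun j : Fin (n + 1) => (x (j + 1)).1) (fun j => (x (j + 1)).2) (Fin.last n) := by
  symm
  refine Finset.card_bij (fun m _ => (m : ℕ) + 1) ?_ (fun a _ b _ h => Fin.ext (by simpa using h)) ?_
  · intro m hm
    simp only [mem_filter, mem_univ, true_and, Finset.ext_iff, belowSet, mem_singleton] at hm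
    have hlast := (hm (Fin.last n)).2 rfl
    have hmn : (m : ℕ) < n := by
      rcases (Nat.lt_succ_iff_lt_or_eq.1 m.isLt) with h | h
      · exact h
      · simp [h] at hlast
    simp only [killed, mem_filter, mem_Ico, IsCurrentRecord, Below, Nat.add_sub_cancel]
    refine ⟨by omega, ⟨by omega, by omega, fun i h1 h2 hb => ?_⟩, fun h => ?_⟩
    · have := (hm ⟨i - 1, by omega⟩).1 (by simpa [Nat.sub_add_cancel h1] using hb)
      simp [Fin.ext_iff] at this
      omega
    · exact h.2.2 (n + 1) (by omega) le_rfl (by simpa using hlast)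
  · intro j hj
    simp only [killed, mem_filter, mem_Ico, IsCurrentRecord, Below, Nat.add_sub_cancel] at hj
    obtain ⟨⟨h1, h2⟩, ⟨-, -, h3⟩, h4⟩ := hj
    refine ⟨⟨j - 1, by omega⟩, ?_, by simp; omega⟩
    simp only [mem_filter, mem_univ, true_and, Finset.ext_iff, belowSet, mem_singleton,
      Nat.sub_add_cancel h1]
    have hnot (i : Fin (n + 1)) (hi : i ≠ Fin.last n) :
        ¬ ((x (i + 1)).1 < (x j).1 ∧ (x (i + 1)).2 < (x j).2) :=
      h3 _ (by omega) (Nat.succ_le_of_lt (Fin.val_lt_last hi))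
    intro i
    refine ⟨fun hb => by_contra fun hi => hnot i hi hb, ?_⟩
    rintro rfl
    by_contra hb
    refine h4 ⟨h1, h2.le, fun i hi1 hi2 => ?_⟩
    rcases Nat.lt_or_ge i (n + 1) with hi | hi
    · exact h3 i hi1 (by omega)
    · obtain rfl : i = n + 1 := by omega
      simpa using hb

lemma K_nonneg_iff (x : ℕ → ℝ × ℝ) (n : ℕ) : 0 ≤ K x n ↔ IsRecord x n := by
  unfold K
  split_ifs with h <;> simp [h]

lemma K_eq_natCast_iff (x : ℕ → ℝ × ℝ) (n k : ℕ) :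
    K x n = k ↔ IsRecord x n ∧ (killed x n).card = k := by
  unfold K
  split_ifs with h
  · simp [h]
  · simp only [h, false_and]

end Transfer

end ParetoRecords

namespace ParetoRecords

open Finset
open scoped Nat

/-! ### Exact probabilities and the final estimates -/

lemma sum_card_records_eq (n : ℕ) :
    (∑ τ : Equiv.Perm (Fin n), (#{j | belowSet id τ j = ∅} : ℝ)) = recordSum (1 : ℝ) n := by
  simp [recordSum]

lemma sum_card_records_kills_eq (n k : ℕ) :
    (∑ τ : Equiv.Perm (Fin n), (#{j | belowSet id τ j = ∅ ∧ kills id τ j = k} : ℝ))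
      = PowerSeries.coeff k (recordSum (PowerSeries.X : PowerSeries ℝ) n) := by
  simp only [recordSum, map_sum, Finset.card_filter, Nat.cast_sum]
  refine Finset.sum_congr rfl fun τ _ => Finset.sum_congr rfl fun j _ => ?_
  by_cases h : belowSet id τ j = ∅ <;> simp [h, PowerSeries.coeff_X_pow, eq_comm]

lemma cond_real_of_subset {Ω : Type*} [MeasurableSpace Ω] {μ : Measure Ω} {s t : Set Ω}
    (hts : t ⊆ s) :
    (cond μ s).real t = μ.real t / μ.real s := by
  rw [ProbabilityTheory.cond, measureReal_ennreal_smul_apply, measureReal_def (μ.restrict s),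
    Measure.restrict_eq_self μ hts, ENNReal.toReal_inv, ← measureReal_def, ← measureReal_def]
  field_simp

section Probabilities

variable {Ω : Type*} [MeasurableSpace Ω] {μ : Measure Ω} [IsProbabilityMeasure μ]
  {X : ℕ → Ω → ℝ × ℝ}

lemma measureReal_K_eq (hmeas : ∀ i, 1 ≤ i → Measurable (X i))
    (hindep : iIndepFun (fun i : ℕ => X (i + 1)) μ)
    (hunif : ∀ i, 1 ≤ i →
      pdf.IsUniform (X i) (Set.Ioo (0 : ℝ) 1 ×ˢ Set.Ioo (0 : ℝ) 1) μ volume) (n k : ℕ) :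
    μ.real {ω | K (fun i => X i ω) (n + 1) = (k : ℤ)}
      = PowerSeries.coeff k (recordSum (PowerSeries.X : PowerSeries ℝ) (n + 1)) / (n + 1)!
        / (n + 1) := by
  have h := measureReal_record hmeas hindep hunif (Fin.last n) (fun m => m = k)
  rw [sum_card_records_kills_eq] at h
  simp only [K_eq_natCast_iff, isRecord_iff, card_killed]
  rw [h]
  push_cast
  rfl

lemma measureReal_K_nonneg (hmeas : ∀ i, 1 ≤ i → Measurable (X i))
    (hindep : iIndepFun (fun i : ℕ => X (i + 1)) μ)
    (hunif : ∀ i, 1 ≤ i →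
      pdf.IsUniform (X i) (Set.Ioo (0 : ℝ) 1 ×ˢ Set.Ioo (0 : ℝ) 1) μ volume) (n : ℕ) :
    μ.real {ω | 0 ≤ K (fun i => X i ω) (n + 1)} = (harmonic (n + 1) : ℝ) / (n + 1) := by
  have h := measureReal_record hmeas hindep hunif (Fin.last n) (fun _ => True)
  simp only [and_true] at h
  rw [sum_card_records_eq, recordSum_one_right] at h
  simp only [K_nonneg_iff, isRecord_iff]
  rw [h, mul_div_cancel_left₀ _ (by positivity)]
  push_cast
  rfl

end Probabilities

end ParetoRecords

theorem theoremT {Ω : Type*} [MeasurableSpace Ω] (μ : Measure Ω) [IsProbabilityMeasure μ]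
    (X : ℕ → Ω → ℝ × ℝ)
    (hmeas : ∀ i, 1 ≤ i → Measurable (X i))
    (hindep : iIndepFun (fun i : ℕ => X (i + 1)) μ)
    (hunif : ∀ i, 1 ≤ i →
      pdf.IsUniform (X i) (Set.Ioo (0 : ℝ) 1 ×ˢ Set.Ioo (0 : ℝ) 1) μ volume)
    (n : ℕ) (hn : 1 ≤ n) (k : ℕ) :
    |μ.real {ω | ParetoRecords.K (fun i => X i ω) n = (k : ℤ)}
        - ((harmonic n : ℝ) / n / 2 ^ (k + 1) - ((k : ℝ) - 1) / 2 ^ (k + 2) / n)|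
      ≤ 1 / 2 / (n : ℝ) ^ 2
    ∧ 0 < μ {ω | 0 ≤ ParetoRecords.K (fun i => X i ω) n}
    ∧ |(cond μ {ω | 0 ≤ ParetoRecords.K (fun i => X i ω) n}).real
            {ω | ParetoRecords.K (fun i => X i ω) n = (k : ℤ)}
          - (1 / 2 ^ (k + 1) + ParetoRecords.alpha n k)|
        ≤ 1 / (2 * n * (harmonic n : ℝ)) := by
  obtain ⟨m, rfl⟩ : ∃ m, n = m + 1 := ⟨n - 1, by omega⟩
  have hK := ParetoRecords.measureReal_K_eq hmeas hindep hunif m k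
  have hR := ParetoRecords.measureReal_K_nonneg hmeas hindep hunif m
  have hcoeff := ParetoRecords.abs_coeff_recordSum_sub_le m k
  set c := PowerSeries.coeff k (ParetoRecords.recordSum (PowerSeries.X : PowerSeries ℝ) (m + 1))
    / (m + 1).factorial
  have hH : (0 : ℝ) < (harmonic (m + 1) : ℝ) := by exact_mod_cast harmonic_pos (by omega)
  have hm : (0 : ℝ) < (m : ℝ) + 1 := by positivity
  -- The coefficient estimate is stronger than required by a factor of two.
  have hle : 1 / (4 * ((m : ℝ) + 1)) ≤ 1 / 2 / (m + 1) := by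
    rw [div_div]
    gcongr
    norm_num
  refine ⟨?_, ?_, ?_⟩
  · rw [hK]
    push_cast
    have e : c / ((m : ℝ) + 1) - ((harmonic (m + 1) : ℝ) / (m + 1) / 2 ^ (k + 1)
        - ((k : ℝ) - 1) / 2 ^ (k + 2) / (m + 1))
        = (c - ((harmonic (m + 1) : ℝ) / 2 ^ (k + 1) - ((k : ℝ) - 1) / 2 ^ (k + 2)))
          / (m + 1) := by
      field_simp
    rw [e, abs_div, abs_of_pos hm, div_le_iff₀ hm]
    refine (hcoeff.trans hle).trans (le_of_eq ?_)
    field_simp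
  · refine pos_iff_ne_zero.2 fun h0 => ?_
    rw [measureReal_def, h0, ENNReal.toReal_zero] at hR
    exact (div_pos hH hm).ne hR
  · rw [ParetoRecords.cond_real_of_subset (fun ω hω => by
      simp only [Set.mem_ofPred_eq] at hω ⊢
      omega), hK, hR, ParetoRecords.alpha]
    have e : c / ((m : ℝ) + 1) / ((harmonic (m + 1) : ℝ) / (m + 1)) - (1 / 2 ^ (k + 1)
        + -((k : ℝ) - 1) / 2 ^ (k + 2) / (harmonic (m + 1) : ℝ))
        = (c - ((harmonic (m + 1) : ℝ) / 2 ^ (k + 1) - ((k : ℝ) - 1) / 2 ^ (k + 2)))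
          / (harmonic (m + 1) : ℝ) := by
      field_simp
      ring
    rw [e, abs_div, abs_of_pos hH, div_le_iff₀ hH]
    refine (hcoeff.trans hle).trans (le_of_eq ?_)
    push_cast
    field_simp
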